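/- Let $\ell_2$ be the real Hilbert space of square-summable sequences. A name of a point $z\in\ell_2$ is a sequence $(q_n)_{n\in\mathbb{N}}$ of (codes of) finite sequences of rational numbers, regarded as elements of $\ell_2$ with finite support, such that $\lVert q_n-q_m\rVert<2^{-n}$ for all $m>n$ and $q_n\to z$ in norm. A sequence $(x_i)_{i\in\mathbb{N}}$ in $\ell_2$ is computable if there is a computable double sequence $(q_{i,n})_{i,n}$ such that $(q_{i,n})_n$ is a name of $x_i$ for every $i$. A point $z$ is a weak cluster point of $(x_i)_i$ if some subsequence of $(x_i)_i$ converges weakly to $z$. Then there is a computable, norm-bounded sequence $(x_i)_{i\in\mathbb{N}}$ in $\ell_2$ such that every weak cluster point $z$ of $(x_i)_i$ computes the second Turing jump $0''$ of the empty set, i.e. $0''$ is Turing reducible to every name of $z$. -/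

import Mathlib

namespace WeakBW

/-! ### Oracle programs and the Turing jump -/

/-- Programs for the functions that are partial recursive relative to an oracle; one constructor
for each clause of `Nat.RecursiveIn`. -/
inductive OracleCode : Type
  | zero : OracleCode
  | succ : OracleCode
  | left : OracleCode
  | right : OracleCode
  | oracle : OracleCode
  | pair : OracleCode → OracleCode → OracleCode
  | comp : OracleCode → OracleCode → OracleCode
  | prec : OracleCode → OracleCode → OracleCode
  | rfind : OracleCode → OracleCode

namespace OracleCode

/-- The partial function computed by a program with the oracle `g`. -/
def eval (g : ℕ →. ℕ) : OracleCode → ℕ →. ℕ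
  | zero => fun _ => Part.some 0
  | succ => fun n => Part.some (n + 1)
  | left => fun n => Part.some n.unpair.1
  | right => fun n => Part.some n.unpair.2
  | oracle => g
  | pair a b => fun n => Nat.pair <$> eval g a n <*> eval g b n
  | comp a b => fun n => eval g b n >>= eval g a
  | prec a b => fun p =>
      Nat.rec (eval g a p.unpair.1)
        (fun y IH => IH >>= fun i => eval g b (Nat.pair p.unpair.1 (Nat.pair y i))) p.unpair.2
  | rfind a => fun p => Nat.rfind fun n => (fun m => decide (m = 0)) <$> eval g a (Nat.pair p n)

/-- The Gödel numbering: `ofNat e` is the program with index `e`. It follows the numbering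
`Nat.Partrec.Code.ofNatCode` of programs without oracle, with one more basic program. -/
def ofNat : ℕ → OracleCode
  | 0 => zero
  | 1 => succ
  | 2 => left
  | 3 => right
  | 4 => oracle
  | n + 5 =>
    have hm : n / 4 < n + 5 := lt_of_le_of_lt (Nat.div_le_self n 4) (by omega)
    have _h1 : (n / 4).unpair.1 < n + 5 := lt_of_le_of_lt (Nat.unpair_left_le _) hm
    have _h2 : (n / 4).unpair.2 < n + 5 := lt_of_le_of_lt (Nat.unpair_right_le _) hm
    match n % 4 with
    | 0 => pair (ofNat (n / 4).unpair.1) (ofNat (n / 4).unpair.2)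
    | 1 => comp (ofNat (n / 4).unpair.1) (ofNat (n / 4).unpair.2)
    | 2 => prec (ofNat (n / 4).unpair.1) (ofNat (n / 4).unpair.2)
    | _ => rfind (ofNat (n / 4))

end OracleCode

open Classical in
/-- The characteristic function of a set of natural numbers. -/
noncomputable def charFn (A : Set ℕ) (n : ℕ) : ℕ := if n ∈ A then 1 else 0

/-- The Turing jump `A'`: the set of all `e` such that the program with index `e`, run with oracle
`A` on the input `e`, halts. -/
def jump (A : Set ℕ) : Set ℕ :=
  {e | ((OracleCode.ofNat e).eval (fun n => Part.some (charFn A n)) e).Dom}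

/-- The second Turing jump `0''`. -/
def zeroDoubleJump : Set ℕ := jump (jump ∅)

/-! ### The space `ℓ₂` and its names -/

/-- The real Hilbert space `ℓ₂`. -/
abbrev Ell2 : Type := lp (fun _ : ℕ => ℝ) 2

/-- `(a, b, c)` is a code of the rational number `(a - b) / (c + 1)`. -/
abbrev RatCode : Type := ℕ × ℕ × ℕ

/-- The rational number with a given code. -/
def RatCode.toRat (r : RatCode) : ℚ := ((r.1 : ℚ) - (r.2.1 : ℚ)) / ((r.2.2 : ℚ) + 1)

/-- The element `⟨r₀, …, r_m, 0, 0, …⟩` of `ℓ₂` with rational coordinates `r₀, …, r_m`. -/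
noncomputable def ratVec (l : List RatCode) : Ell2 :=
  ∑ k ∈ Finset.range l.length, lp.single 2 k ((RatCode.toRat (l.getD k (0, 0, 0)) : ℚ) : ℝ)

/-- `p` is a name of `x`: a sequence of (codes of) finite rational sequences that converges to `x`
in norm, with `‖p n - p m‖ < 2⁻ⁿ` for all `m > n`. -/
def IsName (p : ℕ → List RatCode) (x : Ell2) : Prop :=
  (∀ n m : ℕ, n < m → ‖ratVec (p n) - ratVec (p m)‖ < (1 / 2 : ℝ) ^ n) ∧
    Filter.Tendsto (fun n => ratVec (p n)) Filter.atTop (nhds x)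

/-- A sequence in `ℓ₂` is computable if names of its members can be computed uniformly. -/
def ComputableSeq (x : ℕ → Ell2) : Prop :=
  ∃ f : ℕ → ℕ → List RatCode, Computable₂ f ∧ ∀ i, IsName (f i) (x i)

/-- Weak convergence in `ℓ₂`. -/
def WeaklyConverges (x : ℕ → Ell2) (z : Ell2) : Prop :=
  ∀ y : Ell2, Filter.Tendsto (fun i => inner ℝ y (x i)) Filter.atTop (nhds (inner ℝ y z))

/-- `z` is a weak cluster point of `x` if some subsequence of `x` converges weakly to `z`. -/
def IsWeakClusterPt (x : ℕ → Ell2) (z : Ell2) : Prop :=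
  ∃ s : ℕ → ℕ, StrictMono s ∧ WeaklyConverges (fun i => x (s i)) z

/-- The point `z` computes the set `A`: `A` is Turing reducible to every name of `z`. -/
def PointComputes (z : Ell2) (A : Set ℕ) : Prop :=
  ∀ p : ℕ → List RatCode, IsName p z →
    TuringReducible (fun n => Part.some (charFn A n)) (fun n => Part.some (Encodable.encode (p n)))

end WeakBW

/-! The set `0''` is Σ₂: by `mem_zeroDoubleJump`, `e` belongs to it iff some `m` passes a decidable
test `WitnessAt e m i` at every stage `i`, and a candidate that fails once fails for ever. Let
`leastWitness i e` be the least candidate below `i` that survives at stage `i`. If `e ∈ 0''` it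
stabilises; otherwise it takes each value only finitely often (`eventually_leastWitness_eq`,
`eventually_leastWitness_ne`).

Index the coordinates by pairs `⟨e, k⟩`, and let `x_i` carry the entry `2⁻ᵉ` at `k = leastWitness i
e`, cut off to coordinates below `i`. Summing over `e` bounds the norms by 2. In a weak limit, block
`e` keeps an entry `2⁻ᵉ` if `e ∈ 0''`; otherwise the entry escapes to infinity and the block
vanishes. A name converges in norm, hence uniformly over all `k`, so one finite approximation tells
the two cases apart (`mem_zeroDoubleJump_iff_hasLargeEntry`). -/

namespace WeakBW

open Nat.Partrec (Code)

namespace OracleCode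

/-! ### Monotonicity and compactness of oracle computations -/

section

variable {g : ℕ →. ℕ} {a b : OracleCode} {n k y : ℕ}

theorem mem_eval_pair : y ∈ (pair a b).eval g n ↔
    ∃ v ∈ a.eval g n, ∃ w ∈ b.eval g n, Nat.pair v w = y := by
  simp only [eval, Seq.seq, Part.map_eq_map, Part.bind_map, Part.mem_bind_iff, Part.mem_map_iff]

theorem mem_eval_comp : y ∈ (comp a b).eval g n ↔ ∃ v ∈ b.eval g n, y ∈ a.eval g v :=
  Part.mem_bind_iff

theorem mem_eval_prec_zero : y ∈ (prec a b).eval g (Nat.pair n 0) ↔ y ∈ a.eval g n := by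
  simp [eval]

theorem mem_eval_prec_succ : y ∈ (prec a b).eval g (Nat.pair n (k + 1)) ↔
    ∃ v ∈ (prec a b).eval g (Nat.pair n k), y ∈ b.eval g (Nat.pair n (Nat.pair k v)) := by
  simp [eval]

theorem mem_eval_rfind : y ∈ (rfind a).eval g n ↔
    (∃ v ∈ a.eval g (Nat.pair n y), v = 0) ∧ ∀ m < y, ∃ v ∈ a.eval g (Nat.pair n m), v ≠ 0 := by
  refine Nat.mem_rfind.trans ?_
  simp

end

theorem eval_mono {g h : ℕ →. ℕ} (hgh : ∀ n y, y ∈ g n → y ∈ h n) (c : OracleCode) :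
    ∀ n y, y ∈ c.eval g n → y ∈ c.eval h n := by
  induction c with
  | zero | succ | left | right => exact fun _ _ hy => hy
  | oracle => exact hgh
  | pair a b iha ihb =>
    intro n y hy
    obtain ⟨v, hv, w, hw, rfl⟩ := mem_eval_pair.1 hy
    exact mem_eval_pair.2 ⟨v, iha _ _ hv, w, ihb _ _ hw, rfl⟩
  | comp a b iha ihb =>
    intro n y hy
    obtain ⟨v, hv, hw⟩ := mem_eval_comp.1 hy
    exact mem_eval_comp.2 ⟨v, ihb _ _ hv, iha _ _ hw⟩
  | prec a b iha ihb =>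
    intro p
    obtain ⟨n, k, rfl⟩ : ∃ n k, p = Nat.pair n k := ⟨_, _, (Nat.pair_unpair p).symm⟩
    induction k with
    | zero => exact fun y hy => mem_eval_prec_zero.2 (iha _ _ (mem_eval_prec_zero.1 hy))
    | succ k ih =>
      intro y hy
      obtain ⟨v, hv, hw⟩ := mem_eval_prec_succ.1 hy
      exact mem_eval_prec_succ.2 ⟨v, ih _ hv, ihb _ _ hw⟩
  | rfind a iha =>
    intro n y hy
    obtain ⟨⟨v, hv, hv'⟩, hlt⟩ := mem_eval_rfind.1 hy
    refine mem_eval_rfind.2 ⟨⟨v, iha _ _ hv, hv'⟩, fun m hm => ?_⟩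
    obtain ⟨w, hw, hw'⟩ := hlt m hm
    exact ⟨w, iha _ _ hw, hw'⟩

/-- The partial function `g` restricted to the arguments below `u`. -/
def restrictBelow (g : ℕ →. ℕ) (u : ℕ) : ℕ →. ℕ := fun n => if n < u then g n else Part.none

theorem mem_restrictBelow {g : ℕ →. ℕ} {u n y : ℕ} :
    y ∈ restrictBelow g u n ↔ n < u ∧ y ∈ g n := by
  unfold restrictBelow
  split_ifs with h <;> simp [h]

theorem eval_restrictBelow_mono {g : ℕ →. ℕ} {c : OracleCode} {u v n y : ℕ} (huv : u ≤ v)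
    (hy : y ∈ c.eval (restrictBelow g u) n) : y ∈ c.eval (restrictBelow g v) n :=
  eval_mono (fun _ _ h => by
    rw [mem_restrictBelow] at h ⊢
    exact ⟨h.1.trans_le huv, h.2⟩) c n y hy

theorem eval_of_restrictBelow {g : ℕ →. ℕ} {c : OracleCode} {u n y : ℕ}
    (hy : y ∈ c.eval (restrictBelow g u) n) : y ∈ c.eval g n :=
  eval_mono (fun _ _ h => (mem_restrictBelow.1 h).2) c n y hy

/-- A halting computation asks the oracle only finitely many questions. -/
theorem exists_restrictBelow {g : ℕ →. ℕ} (c : OracleCode) :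
    ∀ n y, y ∈ c.eval g n → ∃ u, y ∈ c.eval (restrictBelow g u) n := by
  induction c with
  | zero | succ | left | right => exact fun _ _ hy => ⟨0, hy⟩
  | oracle => exact fun n y hy => ⟨n + 1, mem_restrictBelow.2 ⟨n.lt_succ_self, hy⟩⟩
  | pair a b iha ihb =>
    intro n y hy
    obtain ⟨v, hv, w, hw, rfl⟩ := mem_eval_pair.1 hy
    obtain ⟨s, hs⟩ := iha _ _ hv
    obtain ⟨t, ht⟩ := ihb _ _ hw
    exact ⟨max s t, mem_eval_pair.2 ⟨v, eval_restrictBelow_mono (le_max_left _ _) hs, w,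
      eval_restrictBelow_mono (le_max_right _ _) ht, rfl⟩⟩
  | comp a b iha ihb =>
    intro n y hy
    obtain ⟨v, hv, hw⟩ := mem_eval_comp.1 hy
    obtain ⟨s, hs⟩ := ihb _ _ hv
    obtain ⟨t, ht⟩ := iha _ _ hw
    exact ⟨max s t, mem_eval_comp.2 ⟨v, eval_restrictBelow_mono (le_max_left _ _) hs,
      eval_restrictBelow_mono (le_max_right _ _) ht⟩⟩
  | prec a b iha ihb =>
    intro p
    obtain ⟨n, k, rfl⟩ : ∃ n k, p = Nat.pair n k := ⟨_, _, (Nat.pair_unpair p).symm⟩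
    induction k with
    | zero =>
      intro y hy
      obtain ⟨u, hu⟩ := iha _ _ (mem_eval_prec_zero.1 hy)
      exact ⟨u, mem_eval_prec_zero.2 hu⟩
    | succ k ih =>
      intro y hy
      obtain ⟨v, hv, hw⟩ := mem_eval_prec_succ.1 hy
      obtain ⟨s, hs⟩ := ih _ hv
      obtain ⟨t, ht⟩ := ihb _ _ hw
      exact ⟨max s t, mem_eval_prec_succ.2 ⟨v, eval_restrictBelow_mono (le_max_left _ _) hs,
        eval_restrictBelow_mono (le_max_right _ _) ht⟩⟩
  | rfind a iha =>
    intro n y hy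
    obtain ⟨⟨v, hv, hv'⟩, hlt⟩ := mem_eval_rfind.1 hy
    obtain ⟨s, hs⟩ := iha _ _ hv
    have hlt' : ∀ m, ∃ t, m < y → ∃ w ∈ a.eval (restrictBelow g t) (Nat.pair n m), w ≠ 0 := by
      intro m
      by_cases hm : m < y
      · obtain ⟨w, hw, hw'⟩ := hlt m hm
        obtain ⟨t, ht⟩ := iha _ _ hw
        exact ⟨t, fun _ => ⟨w, ht, hw'⟩⟩
      · exact ⟨0, fun h => absurd h hm⟩
    choose t ht using hlt'
    refine ⟨max s ((Finset.range y).sup t), mem_eval_rfind.2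
      ⟨⟨v, eval_restrictBelow_mono (le_max_left _ _) hs, hv'⟩, fun m hm => ?_⟩⟩
    obtain ⟨w, hw, hw'⟩ := ht m hm
    exact ⟨w, eval_restrictBelow_mono (le_max_of_le_right
      (Finset.le_sup (f := t) (Finset.mem_range.2 hm))) hw, hw'⟩

/-! ### Replacing a partial recursive oracle by a program for it -/

/-- The program without oracle obtained by substituting `b` for the oracle. -/
def toCode (b : Code) : OracleCode → Code
  | zero => .zero
  | succ => .succ
  | left => .left
  | right => .right
  | oracle => b
  | pair c d => .pair (toCode b c) (toCode b d)
  | comp c d => .comp (toCode b c) (toCode b d)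
  | prec c d => .prec (toCode b c) (toCode b d)
  | rfind c => .comp (.rfind' (toCode b c)) (.pair Code.id .zero)

theorem eval_toCode (b : Code) (c : OracleCode) : (toCode b c).eval = c.eval b.eval := by
  induction c with
  | zero | succ | left | right | oracle => rfl
  | pair c d ihc ihd =>
    simp only [toCode, Code.eval, eval, ihc, ihd]
    rfl
  | comp c d ihc ihd =>
    simp only [toCode, Code.eval, eval, ihc, ihd]
    rfl
  | prec c d ihc ihd =>
    funext p
    simp only [toCode, Code.eval, eval, ihc, ihd, Nat.unpaired]
  | rfind c ihc =>
    funext p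
    -- On `⟨p, k⟩` the program `rfind'` searches from `k` upwards; pairing with 0 gives the full
    -- search.
    have h0 : (Code.pair Code.id .zero).eval p = Part.some (Nat.pair p 0) := by
      simp [Code.eval, Seq.seq, pure, PFun.pure]
    change ((Code.pair Code.id .zero).eval p).bind (Code.rfind' (toCode b c)).eval = _
    rw [h0]
    refine (Part.bind_some _ _).trans ?_
    simp [Code.eval, eval, ihc, Nat.unpaired, Part.map_id']

/-- The step of the course-of-values recursion computing `toCode b (ofNat n)`, where `l` lists the
results for the numbers below `n`. -/
def toCodeStep (b : Code) (l : List Code) : Code :=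
  let n := l.length
  let m := (n - 5) / 4
  let c := l.getD m .zero
  let c₁ := l.getD m.unpair.1 .zero
  let c₂ := l.getD m.unpair.2 .zero
  if n = 0 then .zero else if n = 1 then .succ else if n = 2 then .left else
  if n = 3 then .right else if n = 4 then b else
  if (n - 5) % 4 = 0 then .pair c₁ c₂ else
  if (n - 5) % 4 = 1 then .comp c₁ c₂ else
  if (n - 5) % 4 = 2 then .prec c₁ c₂ else .comp (.rfind' c) (.pair Code.id .zero)

theorem toCodeStep_eq (b : Code) (n : ℕ) :
    toCodeStep b ((List.range n).map fun k => toCode b (ofNat k)) = toCode b (ofNat n) := by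
  have get : ∀ k < n, ((List.range n).map fun k => toCode b (ofNat k)).getD k .zero =
      toCode b (ofNat k) := by
    intro k hk
    simp [List.getD, hk]
  match n, get with
  | 0, _ | 1, _ | 2, _ | 3, _ | 4, _ => simp [toCodeStep, ofNat, toCode]
  | n + 5, get =>
    have hm : n / 4 < n + 5 := lt_of_le_of_lt (Nat.div_le_self n 4) (by omega)
    have h1 : (n / 4).unpair.1 < n + 5 := lt_of_le_of_lt (Nat.unpair_left_le _) hm
    have h2 : (n / 4).unpair.2 < n + 5 := lt_of_le_of_lt (Nat.unpair_right_le _) hm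
    simp only [toCodeStep, List.length_map, List.length_range, Nat.add_sub_cancel, get _ hm,
      get _ h1, get _ h2]
    have h4 : n % 4 < 4 := Nat.mod_lt _ (by norm_num)
    rw [ofNat]
    generalize n % 4 = r at h4
    interval_cases r <;> simp [toCode]

theorem primrec_toCodeStep : Primrec₂ toCodeStep := by
  have n : Primrec fun p : Code × List Code => p.2.length := Primrec.list_length.comp .snd
  have n5 : Primrec fun p : Code × List Code => p.2.length - 5 :=
    Primrec.nat_sub.comp n (.const 5)
  have m : Primrec fun p : Code × List Code => (p.2.length - 5) / 4 :=
    Primrec.nat_div.comp n5 (.const 4)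
  have r : Primrec fun p : Code × List Code => (p.2.length - 5) % 4 :=
    Primrec.nat_mod.comp n5 (.const 4)
  have c := (Primrec.list_getD Code.zero).comp (Primrec.snd (α := Code)) m
  have c₁ := (Primrec.list_getD Code.zero).comp (Primrec.snd (α := Code))
    (Primrec.fst.comp (Primrec.unpair.comp m))
  have c₂ := (Primrec.list_getD Code.zero).comp (Primrec.snd (α := Code))
    (Primrec.snd.comp (Primrec.unpair.comp m))
  exact Primrec.ite (Primrec.eq.comp n (.const 0)) (.const _) <|
    Primrec.ite (Primrec.eq.comp n (.const 1)) (.const _) <|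
    Primrec.ite (Primrec.eq.comp n (.const 2)) (.const _) <|
    Primrec.ite (Primrec.eq.comp n (.const 3)) (.const _) <|
    Primrec.ite (Primrec.eq.comp n (.const 4)) .fst <|
    Primrec.ite (Primrec.eq.comp r (.const 0)) (Code.primrec₂_pair.comp c₁ c₂) <|
    Primrec.ite (Primrec.eq.comp r (.const 1)) (Code.primrec₂_comp.comp c₁ c₂) <|
    Primrec.ite (Primrec.eq.comp r (.const 2)) (Code.primrec₂_prec.comp c₁ c₂) <|
    Code.primrec₂_comp.comp (Code.primrec_rfind'.comp c) (.const _)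

/-- The substituted program `b` must be an argument here, because the stage approximations to `jump
∅` use a different program at each stage. -/
theorem primrec_toCode_ofNat : Primrec₂ fun (b : Code) (n : ℕ) => toCode b (ofNat n) :=
  Primrec.nat_strong_rec _ (Primrec.option_some.comp₂ primrec_toCodeStep)
    fun b n => congrArg some (toCodeStep_eq b n)

end OracleCode

/-! ### The second jump as a `Σ₂` set -/

open OracleCode

/-- The program with index `e` and the program `b` in place of the oracle halts on the input `e`
within `s` steps. -/
def HaltsWithin (b : Code) (e s : ℕ) : Prop :=
  (Code.evaln s (toCode b (ofNat e)) e).isSome = true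

instance (b : Code) (e s : ℕ) : Decidable (HaltsWithin b e s) :=
  inferInstanceAs (Decidable (_ = _))

theorem primrec_haltsWithin {α : Type*} [Primcodable α] {b : α → Code} {e s : α → ℕ}
    (hb : Primrec b) (he : Primrec e) (hs : Primrec s) :
    PrimrecPred fun a => HaltsWithin (b a) (e a) (s a) :=
  Primrec.eq.comp (Primrec.option_isSome.comp (Code.primrec_evaln.comp
    ((hs.pair (primrec_toCode_ofNat.comp hb he)).pair he))) (.const true)

theorem HaltsWithin.mono {b : Code} {e s t : ℕ} (hst : s ≤ t) (h : HaltsWithin b e s) :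
    HaltsWithin b e t := by
  unfold HaltsWithin at h ⊢
  obtain ⟨y, hy⟩ := Option.isSome_iff_exists.1 h
  exact Option.isSome_iff_exists.2 ⟨y, Code.evaln_mono hst hy⟩

theorem exists_haltsWithin {b : Code} {e : ℕ} :
    (∃ s, HaltsWithin b e s) ↔ ((ofNat e).eval b.eval e).Dom := by
  simp only [HaltsWithin, Option.isSome_iff_exists, Part.dom_iff_mem, ← eval_toCode,
    Code.evaln_complete, Option.mem_def]
  exact exists_comm

/-- The set `jump ∅` enumerated up to stage `s`. -/
def jumpApprox (s n : ℕ) : Prop := HaltsWithin .zero n s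

instance (s n : ℕ) : Decidable (jumpApprox s n) := inferInstanceAs (Decidable (HaltsWithin _ _ _))

theorem jumpApprox.mono {s t n : ℕ} (hst : s ≤ t) (h : jumpApprox s n) : jumpApprox t n :=
  HaltsWithin.mono hst h

theorem mem_jump_empty {n : ℕ} : n ∈ jump ∅ ↔ ∃ s, jumpApprox s n := by
  have : Code.zero.eval = fun n => Part.some (charFn ∅ n) := by
    funext n
    simp [Code.eval, charFn, pure, PFun.pure]
  simp only [jumpApprox, exists_haltsWithin, this]
  rfl

/-- The characteristic function of `jumpApprox s`, restricted to the arguments below `u`, as a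
partial function of `⟨⟨u, s⟩, n⟩`. -/
def approxOracle (p : ℕ) : Part ℕ :=
  if p.unpair.2 < p.unpair.1.unpair.1 then
    Part.some (if jumpApprox p.unpair.1.unpair.2 p.unpair.2 then 1 else 0)
  else Part.none

theorem partrec_approxOracle : Nat.Partrec approxOracle := by
  have u : Primrec fun p : ℕ => p.unpair.1.unpair.1 :=
    Primrec.fst.comp (Primrec.unpair.comp (Primrec.fst.comp Primrec.unpair))
  have s : Primrec fun p : ℕ => p.unpair.1.unpair.2 :=
    Primrec.snd.comp (Primrec.unpair.comp (Primrec.fst.comp Primrec.unpair))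
  have n : Primrec fun p : ℕ => p.unpair.2 := Primrec.snd.comp Primrec.unpair
  refine Partrec.nat_iff.1 ((Partrec.cond (Primrec.nat_lt.comp n u).decide.to_comp
    (Primrec.ite (primrec_haltsWithin (.const .zero) n s) (.const 1) (.const 0)).to_comp.partrec
    Partrec.none).of_eq fun p => ?_)
  by_cases h : p.unpair.2 < p.unpair.1.unpair.1 <;> simp [approxOracle, h, jumpApprox]
  congr

/-- A program for the characteristic function of `jumpApprox s` below `u`, where `m = ⟨u, s⟩`. -/
noncomputable def approxCode (m : ℕ) : Code :=
  Code.curry (Code.exists_code.1 partrec_approxOracle).choose m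

/-- The program obtained by choice is one fixed constant; `m` enters only through `Code.curry`. -/
theorem primrec_approxCode : Primrec approxCode :=
  Code.primrec₂_curry.comp (.const _) .id

theorem eval_approxCode (u s : ℕ) : (approxCode (Nat.pair u s)).eval =
    restrictBelow (fun n => Part.some (if jumpApprox s n then 1 else 0)) u := by
  funext n
  rw [approxCode, Code.eval_curry, (Code.exists_code.1 partrec_approxOracle).choose_spec]
  simp [approxOracle, restrictBelow]

/-- The number `m = ⟨⟨u, s⟩, k⟩` looks at stage `i` like a witness of `e ∈ zeroDoubleJump`: the program `e`
halts within `k` steps with the oracle `jump ∅` enumerated up to stage `s`, asking only questions below `u`,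
and these are not answered differently at stage `i`. -/
def WitnessAt (e m i : ℕ) : Prop :=
  HaltsWithin (approxCode m.unpair.1) e m.unpair.2 ∧
    ∀ j < m.unpair.1.unpair.1, jumpApprox i j → jumpApprox m.unpair.1.unpair.2 j

noncomputable instance (e m i : ℕ) : Decidable (WitnessAt e m i) :=
  inferInstanceAs (Decidable (_ ∧ _))

/-- The enumeration of `jump ∅` only grows, so a refuted candidate stays refuted. -/
theorem WitnessAt.anti {e m i j : ℕ} (hij : i ≤ j) (h : WitnessAt e m j) : WitnessAt e m i :=
  ⟨h.1, fun k hk hi => h.2 k hk (hi.mono hij)⟩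

theorem primrec_witnessAt :
    PrimrecPred fun p : ℕ × ℕ × ℕ => WitnessAt p.1 p.2.1 p.2.2 := by
  have e : Primrec fun p : ℕ × ℕ × ℕ => p.1 := .fst
  have m : Primrec fun p : ℕ × ℕ × ℕ => p.2.1 := Primrec.fst.comp .snd
  have c : Primrec fun p : ℕ × ℕ × ℕ => p.2.1.unpair.1 := Primrec.fst.comp (Primrec.unpair.comp m)
  have k : Primrec fun p : ℕ × ℕ × ℕ => p.2.1.unpair.2 := Primrec.snd.comp (Primrec.unpair.comp m)
  have u := Primrec.fst.comp (Primrec.unpair.comp c)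
  have s := Primrec.snd.comp (Primrec.unpair.comp c)
  have R : PrimrecRel fun (j : ℕ) (q : ℕ × ℕ) => jumpApprox q.1 j → jumpApprox q.2 j := by
    -- On triples `(j, q)` the projections `e` and `m` now yield `j` and the first stage `q.1`.
    have h₁ : PrimrecPred fun p : ℕ × ℕ × ℕ => jumpApprox p.2.1 p.1 :=
      primrec_haltsWithin (.const Code.zero) e m
    have h₂ : PrimrecPred fun p : ℕ × ℕ × ℕ => jumpApprox p.2.2 p.1 :=
      primrec_haltsWithin (.const Code.zero) e (Primrec.snd.comp .snd)
    exact (h₁.not.or h₂).of_eq fun p => by tauto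
  refine PrimrecPred.and (primrec_haltsWithin (primrec_approxCode.comp c) e k) ?_
  exact ((R.forall_mem_list.comp (Primrec.list_range.comp u)
    ((Primrec.snd.comp (Primrec.snd (α := ℕ))).pair s))).of_eq fun p => by simp

/-- A halting computation with oracle `jump ∅` asks only questions below some `u`, and some stage
`s` has already enumerated all of `jump ∅` below `u`. Conversely, surviving every stage means that
stage `s` is correct below `u`, so the simulated computation is the true one. -/
theorem mem_zeroDoubleJump {e : ℕ} : e ∈ zeroDoubleJump ↔ ∃ m, ∀ i, WitnessAt e m i := by
  have oracle_eq : ∀ u s, (∀ j < u, jumpApprox s j ↔ j ∈ jump ∅) →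
      restrictBelow (fun n => Part.some (if jumpApprox s n then 1 else 0)) u =
        restrictBelow (fun n => Part.some (charFn (jump ∅) n)) u := by
    intro u s h
    funext n
    unfold restrictBelow
    split_ifs with hn
    · by_cases hs : jumpApprox s n
      · simp [charFn, hs, (h n hn).1 hs]
      · simp [charFn, hs, mt (h n hn).2 hs]
    · rfl
  constructor
  · intro he
    obtain ⟨y, hy⟩ := Part.dom_iff_mem.1 he
    obtain ⟨u, hu⟩ := exists_restrictBelow _ _ _ hy
    have stage : ∀ j, ∃ s, j ∈ jump ∅ → jumpApprox s j := fun j => by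
      by_cases hj : j ∈ jump ∅
      · exact (mem_jump_empty.1 hj).imp fun _ h _ => h
      · exact ⟨0, fun h => absurd h hj⟩
    choose t ht using stage
    have agree : ∀ j < u, jumpApprox ((Finset.range u).sup t) j ↔ j ∈ jump ∅ :=
      fun j hj => ⟨fun h => mem_jump_empty.2 ⟨_, h⟩, fun h => (ht j h).mono
        (Finset.le_sup (f := t) (Finset.mem_range.2 hj))⟩
    have hdom : ((ofNat e).eval (approxCode (Nat.pair u ((Finset.range u).sup t))).eval e).Dom := by
      rw [eval_approxCode, oracle_eq u _ agree]
      exact Part.dom_iff_mem.2 ⟨y, hu⟩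
    obtain ⟨k, hk⟩ := exists_haltsWithin.2 hdom
    refine ⟨Nat.pair (Nat.pair u ((Finset.range u).sup t)) k, fun i => ?_⟩
    simp only [WitnessAt, Nat.unpair_pair]
    exact ⟨hk, fun j hj hi => (agree j hj).2 (mem_jump_empty.2 ⟨i, hi⟩)⟩
  · rintro ⟨m, hm⟩
    obtain ⟨u, s, k, rfl⟩ : ∃ u s k, m = Nat.pair (Nat.pair u s) k :=
      ⟨_, _, m.unpair.2, by rw [Nat.pair_unpair, Nat.pair_unpair]⟩
    simp only [WitnessAt, Nat.unpair_pair] at hm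
    have hdom := exists_haltsWithin.1 ⟨_, (hm 0).1⟩
    rw [eval_approxCode, oracle_eq u s fun j hj => ⟨fun h => mem_jump_empty.2 ⟨s, h⟩, fun h => by
      obtain ⟨i, hi⟩ := mem_jump_empty.1 h
      exact (hm i).2 j hj hi⟩] at hdom
    obtain ⟨y, hy⟩ := Part.dom_iff_mem.1 hdom
    exact Part.dom_iff_mem.2 ⟨y, eval_of_restrictBelow hy⟩

/-! ### Coordinates of points and of their names -/

theorem ratVec_apply (l : List RatCode) (j : ℕ) :
    ratVec l j = ((l.getD j (0, 0, 0)).toRat : ℝ) := by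
  simp only [ratVec, lp.coeFn_sum, Finset.sum_apply, lp.single_apply, Pi.single_apply]
  rw [Finset.sum_ite_eq (Finset.range l.length) j]
  split_ifs with h
  · rfl
  · rw [List.getD_eq_default _ _ (by simpa using h)]
    simp [RatCode.toRat]

/-- The bound does not depend on the coordinate, so one `p n` controls an entire infinite block. -/
theorem IsName.abs_sub_le {p : ℕ → List RatCode} {z : Ell2} (hp : IsName p z) (n j : ℕ) :
    |ratVec (p n) j - z j| ≤ (1 / 2 : ℝ) ^ n := by
  have hlim : Filter.Tendsto (fun m => ‖ratVec (p n) - ratVec (p m)‖) Filter.atTop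
      (nhds ‖ratVec (p n) - z‖) := (tendsto_const_nhds.sub hp.2).norm
  have hle : ‖ratVec (p n) - z‖ ≤ (1 / 2 : ℝ) ^ n :=
    le_of_tendsto hlim ((Filter.eventually_gt_atTop n).mono fun m hm => (hp.1 n m hm).le)
  exact (lp.norm_apply_le_norm two_ne_zero (ratVec (p n) - z) j).trans hle

theorem WeaklyConverges.tendsto_apply {x : ℕ → Ell2} {z : Ell2} (h : WeaklyConverges x z) (j : ℕ) :
    Filter.Tendsto (fun i => x i j) Filter.atTop (nhds (z j)) := by
  simpa [lp.inner_single_left] using h (lp.single 2 j 1)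

/-! ### The sequence -/

/-- The least number below `i` that looks at stage `i` like a witness of `e ∈ zeroDoubleJump`, or `i` if there
is none. -/
noncomputable def leastWitness (i e : ℕ) : ℕ :=
  (List.range i).findIdx fun m => decide (WitnessAt e m i)

theorem witnessAt_leastWitness {i e : ℕ} (h : leastWitness i e < i) :
    WitnessAt e (leastWitness i e) i := by
  unfold leastWitness at h ⊢
  have := List.findIdx_getElem (w := h.trans_eq List.length_range.symm)
  rwa [List.getElem_range, decide_eq_true_iff] at this

theorem leastWitness_eq {i e m : ℕ} (hm : m < i) (h : WitnessAt e m i)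
    (hlt : ∀ k < m, ¬ WitnessAt e k i) : leastWitness i e = m := by
  have hm' : m < (List.range i).length := by simpa using hm
  refine (List.findIdx_eq hm').2 ⟨by simpa using h, fun k hk => ?_⟩
  simpa using hlt k hk

/-- The finitely many candidates below the true least witness are all refuted from some stage on. -/
theorem eventually_leastWitness_eq {e : ℕ} (he : e ∈ zeroDoubleJump) :
    ∃ m, ∀ᶠ i in Filter.atTop, leastWitness i e = m := by
  classical
  have hex := mem_zeroDoubleJump.1 he
  refine ⟨Nat.find hex, ?_⟩
  have hlt : ∀ᶠ i in Filter.atTop, ∀ k ∈ Finset.range (Nat.find hex), ¬ WitnessAt e k i := by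
    rw [Filter.eventually_all_finset]
    intro k hk
    obtain ⟨i, hi⟩ := not_forall.1 (Nat.find_min hex (Finset.mem_range.1 hk))
    exact (Filter.eventually_ge_atTop i).mono fun j hj h => hi (h.anti hj)
  filter_upwards [hlt, Filter.eventually_gt_atTop (Nat.find hex)] with i hi hgt
  exact leastWitness_eq hgt (Nat.find_spec hex i) fun k hk => hi k (Finset.mem_range.2 hk)

theorem eventually_leastWitness_ne {e : ℕ} (he : e ∉ zeroDoubleJump) (m : ℕ) :
    ∀ᶠ i in Filter.atTop, leastWitness i e ≠ m := by
  rw [mem_zeroDoubleJump, not_exists] at he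
  obtain ⟨j, hj⟩ := not_forall.1 (he m)
  -- Requiring `m < i` excludes the default value `i` of `leastWitness`, which need not be a
  -- witness.
  filter_upwards [Filter.eventually_ge_atTop j, Filter.eventually_gt_atTop m] with i hi hgt h
  subst h
  exact hj ((witnessAt_leastWitness hgt).anti hi)

theorem primrec_leastWitness : Primrec₂ leastWitness :=
  Primrec.list_findIdx (Primrec.list_range.comp .fst)
    (primrec_witnessAt.comp ((Primrec.snd.comp .fst).pair
      (Primrec.snd.pair (Primrec.fst.comp .fst)))).decide

/-- The `j`-th rational coordinate of the `i`-th member of the sequence: for `j = ⟨e, k⟩` it is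
`2⁻ᵉ` if `k` is the current least witness of `e ∈ zeroDoubleJump`, and `0` otherwise. -/
noncomputable def seqEntry (i j : ℕ) : RatCode :=
  -- A code `(a, b, c)` has denominator `c + 1`, whence the `- 1`.
  if leastWitness i j.unpair.1 = j.unpair.2 then (1, 0, 2 ^ j.unpair.1 - 1) else (0, 0, 0)

/-- The `i`-th member of the sequence, as a finite sequence of rational numbers. -/
noncomputable def seqList (i : ℕ) : List RatCode := (List.range i).map (seqEntry i)

theorem primrec_two_pow : Primrec fun n : ℕ => 2 ^ n :=
  (Primrec.nat_rec₁ 1 (Primrec.nat_mul.comp .snd (.const 2)).to₂).of_eq fun n => by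
    induction n with
    | zero => rfl
    | succ n ih => simp only [pow_succ, ← ih]

theorem primrec_seqList : Primrec seqList := by
  refine Primrec.list_map Primrec.list_range ?_
  have e : Primrec fun p : ℕ × ℕ => p.2.unpair.1 := Primrec.fst.comp (Primrec.unpair.comp .snd)
  have k : Primrec fun p : ℕ × ℕ => p.2.unpair.2 := Primrec.snd.comp (Primrec.unpair.comp .snd)
  exact Primrec.ite (Primrec.eq.comp (primrec_leastWitness.comp .fst e) k)
    ((Primrec.const 1).pair ((Primrec.const 0).pair
      (Primrec.nat_sub.comp (primrec_two_pow.comp e) (.const 1)))) (.const _)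

theorem toRat_seqEntry (i j : ℕ) : ((seqEntry i j).toRat : ℝ) =
    if leastWitness i j.unpair.1 = j.unpair.2 then (1 / 2 : ℝ) ^ j.unpair.1 else 0 := by
  unfold seqEntry
  split_ifs with h
  · simp [RatCode.toRat, Nat.cast_sub Nat.one_le_two_pow]
  · simp [RatCode.toRat]

theorem eventually_ratVec_seqList (j : ℕ) : ∀ᶠ i in Filter.atTop, ratVec (seqList i) j =
    if leastWitness i j.unpair.1 = j.unpair.2 then (1 / 2 : ℝ) ^ j.unpair.1 else 0 := by
  filter_upwards [Filter.eventually_gt_atTop j] with i hi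
  rw [ratVec_apply, ← toRat_seqEntry]
  simp [seqList, List.getD, hi]

/-- Each `e` contributes at most one nonzero entry, of size `2⁻ᵉ`, so the triangle inequality leaves
a geometric series. -/
theorem norm_ratVec_seqList_le (i : ℕ) : ‖ratVec (seqList i)‖ ≤ 2 := by
  have hterm : ∀ j ∈ Finset.range (seqList i).length,
      ‖lp.single (E := fun _ : ℕ => ℝ) 2 j (((seqList i).getD j (0, 0, 0)).toRat : ℝ)‖ =
        if leastWitness i j.unpair.1 = j.unpair.2 then (1 / 2 : ℝ) ^ j.unpair.1 else 0 := by
    intro j hj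
    have hj' : j < i := by simpa [seqList] using hj
    have : (seqList i).getD j (0, 0, 0) = seqEntry i j := by simp [seqList, List.getD, hj']
    rw [lp.norm_single (by norm_num), this, toRat_seqEntry, Real.norm_of_nonneg]
    split_ifs <;> positivity
  calc ‖ratVec (seqList i)‖
      ≤ ∑ j ∈ Finset.range i,
          if leastWitness i j.unpair.1 = j.unpair.2 then (1 / 2 : ℝ) ^ j.unpair.1 else 0 := by
        refine (norm_sum_le _ _).trans (le_of_eq ?_)
        rw [Finset.sum_congr rfl hterm]
        simp [seqList]
    _ = ∑ q ∈ (Finset.range i).image Nat.unpair,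
          if leastWitness i q.1 = q.2 then (1 / 2 : ℝ) ^ q.1 else 0 := by
        rw [Finset.sum_image fun a _ b _ h => by
          rw [← Nat.pair_unpair a, h, Nat.pair_unpair]]
    _ ≤ ∑ q ∈ Finset.range i ×ˢ Finset.range i,
          if leastWitness i q.1 = q.2 then (1 / 2 : ℝ) ^ q.1 else 0 := by
        refine Finset.sum_le_sum_of_subset_of_nonneg ?_ fun q _ _ => by split_ifs <;> positivity
        intro q hq
        obtain ⟨j, hj, rfl⟩ := Finset.mem_image.1 hq
        rw [Finset.mem_range] at hj
        exact Finset.mem_product.2 ⟨Finset.mem_range.2 ((Nat.unpair_left_le j).trans_lt hj),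
          Finset.mem_range.2 ((Nat.unpair_right_le j).trans_lt hj)⟩
    _ ≤ ∑ e ∈ Finset.range i, (1 / 2 : ℝ) ^ e := by
        rw [Finset.sum_product]
        refine Finset.sum_le_sum fun e _ => ?_
        dsimp only
        rw [Finset.sum_ite_eq]
        split_ifs
        · rfl
        · positivity
    _ ≤ 2 := sum_geometric_two_le i

/-! ### Reading off the second jump from a weak cluster point -/

theorem clusterPt_apply_of_mem {z : Ell2} (hz : IsWeakClusterPt (fun i => ratVec (seqList i)) z)
    {e : ℕ} (he : e ∈ zeroDoubleJump) : ∃ k, z (Nat.pair e k) = (1 / 2 : ℝ) ^ e := by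
  obtain ⟨s, hs, hconv⟩ := hz
  obtain ⟨k, hk⟩ := eventually_leastWitness_eq he
  refine ⟨k, tendsto_nhds_unique (hconv.tendsto_apply (Nat.pair e k))
    (tendsto_const_nhds.congr' ?_)⟩
  filter_upwards [hs.tendsto_atTop.eventually (eventually_ratVec_seqList (Nat.pair e k)),
    hs.tendsto_atTop.eventually hk] with i hi hki
  rw [hi]
  simp [hki]

theorem clusterPt_apply_of_notMem {z : Ell2}
    (hz : IsWeakClusterPt (fun i => ratVec (seqList i)) z) {e : ℕ} (he : e ∉ zeroDoubleJump)
    (k : ℕ) : z (Nat.pair e k) = 0 := by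
  obtain ⟨s, hs, hconv⟩ := hz
  refine tendsto_nhds_unique (hconv.tendsto_apply (Nat.pair e k)) (tendsto_const_nhds.congr' ?_)
  filter_upwards [hs.tendsto_atTop.eventually (eventually_ratVec_seqList (Nat.pair e k)),
    hs.tendsto_atTop.eventually (eventually_leastWitness_ne he k)] with i hi hki
  rw [hi]
  simp [hki]

/-- Some coordinate `⟨e, k⟩` of the rational sequence `l` exceeds `2⁻ᵉ / 2`. -/
def HasLargeEntry (e : ℕ) (l : List RatCode) : Prop :=
  ∃ k ∈ List.range l.length, 2 ^ (e + 1) * (l.getD (Nat.pair e k) (0, 0, 0)).2.1 +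
    ((l.getD (Nat.pair e k) (0, 0, 0)).2.2 + 1) <
      2 ^ (e + 1) * (l.getD (Nat.pair e k) (0, 0, 0)).1

instance (e : ℕ) (l : List RatCode) : Decidable (HasLargeEntry e l) :=
  inferInstanceAs (Decidable (∃ k ∈ _, _))

theorem primrec_hasLargeEntry : PrimrecPred fun p : ℕ × List RatCode => HasLargeEntry p.1 p.2 := by
  have k : Primrec fun p : ℕ × ℕ × List RatCode => p.1 := .fst
  have e : Primrec fun p : ℕ × ℕ × List RatCode => p.2.1 := Primrec.fst.comp .snd
  have pow := primrec_two_pow.comp (Primrec.succ.comp e)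
  have l : Primrec fun p : ℕ × ℕ × List RatCode => p.2.2 := Primrec.snd.comp .snd
  have c := (Primrec.list_getD ((0, 0, 0) : RatCode)).comp l (Primrec₂.natPair.comp e k)
  have R : PrimrecRel fun (k : ℕ) (q : ℕ × List RatCode) =>
      2 ^ (q.1 + 1) * (q.2.getD (Nat.pair q.1 k) (0, 0, 0)).2.1 +
        ((q.2.getD (Nat.pair q.1 k) (0, 0, 0)).2.2 + 1) <
          2 ^ (q.1 + 1) * (q.2.getD (Nat.pair q.1 k) (0, 0, 0)).1 :=
    Primrec.nat_lt.comp
      (Primrec.nat_add.comp (Primrec.nat_mul.comp pow (Primrec.fst.comp (Primrec.snd.comp c)))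
        (Primrec.succ.comp (Primrec.snd.comp (Primrec.snd.comp c))))
      (Primrec.nat_mul.comp pow (Primrec.fst.comp c))
  exact R.exists_mem_list.comp (Primrec.list_range.comp (Primrec.list_length.comp .snd)) .id

/-- Clearing denominators and moving the negative part across keeps the test within `ℕ`. Bounding
`k` by the length loses nothing: `k ≤ ⟨e, k⟩`, and entries beyond the length are 0. -/
theorem hasLargeEntry_iff {e : ℕ} {l : List RatCode} :
    HasLargeEntry e l ↔ ∃ k, (1 / 2 : ℝ) ^ (e + 1) < ratVec l (Nat.pair e k) := by
  have key : ∀ r : RatCode, 2 ^ (e + 1) * r.2.1 + (r.2.2 + 1) < 2 ^ (e + 1) * r.1 ↔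
      (1 / 2 : ℝ) ^ (e + 1) < (r.toRat : ℝ) := by
    intro r
    have hpos : (0 : ℝ) < (r.2.2 : ℝ) + 1 := by positivity
    have hpow : (0 : ℝ) < 2 ^ (e + 1) := by positivity
    rw [RatCode.toRat]
    push_cast
    rw [one_div, inv_pow, inv_eq_one_div, div_lt_div_iff₀ hpow hpos, ← Nat.cast_lt (α := ℝ)]
    push_cast
    constructor <;> intro h <;> linarith
  simp only [HasLargeEntry, List.mem_range, key, ratVec_apply]
  refine ⟨fun ⟨k, _, hk⟩ => ⟨k, hk⟩, fun ⟨k, hk⟩ => ⟨k, ?_, hk⟩⟩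
  by_contra hlen
  rw [List.getD_eq_default _ _ ((not_lt.1 hlen).trans (Nat.right_le_pair e k))] at hk
  have : (0 : ℝ) < (1 / 2 : ℝ) ^ (e + 1) := by positivity
  simp only [RatCode.toRat, Nat.cast_zero, sub_zero, zero_div, Rat.cast_zero] at hk
  linarith

/-- With error at most `2⁻ᵉ / 4`, an entry `2⁻ᵉ` of `z` stays above the threshold `2⁻ᵉ / 2` and an
entry 0 stays below it. -/
theorem mem_zeroDoubleJump_iff_hasLargeEntry {z : Ell2}
    (hz : IsWeakClusterPt (fun i => ratVec (seqList i)) z) {p : ℕ → List RatCode}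
    (hp : IsName p z) (e : ℕ) : e ∈ zeroDoubleJump ↔ HasLargeEntry e (p (e + 2)) := by
  have hpos : (0 : ℝ) < (1 / 2 : ℝ) ^ e := by positivity
  have h1 : (1 / 2 : ℝ) ^ (e + 1) = (1 / 2 : ℝ) ^ e / 2 := by ring
  have h2 : (1 / 2 : ℝ) ^ (e + 2) = (1 / 2 : ℝ) ^ e / 4 := by ring
  rw [hasLargeEntry_iff]
  constructor
  · intro he
    obtain ⟨k, hk⟩ := clusterPt_apply_of_mem hz he
    have := abs_le.1 (hp.abs_sub_le (e + 2) (Nat.pair e k))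
    exact ⟨k, by linarith⟩
  · rintro ⟨k, hk⟩
    by_contra he
    have := abs_le.1 (hp.abs_sub_le (e + 2) (Nat.pair e k))
    rw [clusterPt_apply_of_notMem hz he k] at this
    linarith

/-- A set that is decided by a primitive recursive test on `e` and one value of a function at a
primitive recursive argument is Turing reducible to that function. -/
theorem turingReducible_of_primrecPred {σ : Type*} [Primcodable σ] {A : Set ℕ} {p : ℕ → σ}
    {q : ℕ → ℕ} (hq : Primrec q) {T : ℕ → σ → Prop} (hT : PrimrecPred fun a : ℕ × σ => T a.1 a.2)
    (h : ∀ e, e ∈ A ↔ T e (p (q e))) :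
    TuringReducible (fun n => Part.some (charFn A n))
      (fun n => Part.some (Encodable.encode (p n))) := by
  classical
  -- The default 0 for undecodable numbers is never used, since the oracle returns only codes of
  -- values of `p`.
  have hdec : Primrec fun c : ℕ => ((Encodable.decode (α := σ) c.unpair.2).map fun s =>
      if T c.unpair.1 s then 1 else 0).getD 0 :=
    Primrec.option_getD.comp (Primrec.option_map
      (Primrec.decode.comp (Primrec.snd.comp Primrec.unpair))
      (Primrec.ite (PrimrecPred.comp (f := fun a : ℕ × σ => (a.1.unpair.1, a.2)) hT
        ((Primrec.fst.comp (Primrec.unpair.comp .fst)).pair .snd))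
        (.const 1) (.const 0))) (.const 0)
  refine RecursiveIn.iff_nat.2 ?_
  have horacle := Nat.RecursiveIn.comp (Nat.RecursiveIn.oracle
    (O := {fun n => Part.some (Encodable.encode (p n))}) _ rfl)
    (Nat.Primrec.recursiveIn (Primrec.nat_iff.1 hq))
  have hid := Nat.Primrec.recursiveIn (O := {fun n => Part.some (Encodable.encode (p n))})
    (Primrec.nat_iff.1 Primrec.id)
  refine (Nat.RecursiveIn.comp (Nat.Primrec.recursiveIn (Primrec.nat_iff.1 hdec))
    (Nat.RecursiveIn.pair hid horacle)).of_eq fun e => ?_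
  by_cases he : T e (p (q e)) <;> simp [charFn, h, he, Seq.seq]

end WeakBW

theorem mainTheorem4 :
    ∃ x : ℕ → WeakBW.Ell2,
      WeakBW.ComputableSeq x ∧
      (∃ C : ℝ, ∀ i, ‖x i‖ ≤ C) ∧
      ∀ z : WeakBW.Ell2, WeakBW.IsWeakClusterPt x z →
        WeakBW.PointComputes z WeakBW.zeroDoubleJump := by
  -- Every `x i` is itself a finite rational vector, so a constant sequence names it.
  refine ⟨fun i => WeakBW.ratVec (WeakBW.seqList i),
    ⟨fun i _ => WeakBW.seqList i, ?_, fun i => ⟨fun n m _ => ?_, ?_⟩⟩,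
    ⟨2, WeakBW.norm_ratVec_seqList_le⟩, fun z hz p hp => ?_⟩
  · exact (WeakBW.primrec_seqList.comp .fst).to_comp
  · simp
  · exact tendsto_const_nhds
  · exact WeakBW.turingReducible_of_primrecPred (Primrec.nat_add.comp .id (.const 2))
      WeakBW.primrec_hasLargeEntry (WeakBW.mem_zeroDoubleJump_iff_hasLargeEntry hz hp)
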